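/- **Setting.** Let $V$ (variables) and $F$ (constraints) be disjoint finite sets, $W\subseteq V$ (exogenous variables), and let $\mathcal X_v$ ($v\in V$) and $\mathcal Y_f$ ($f\in F$) be standard Borel spaces; write $\mathcal X_A=\prod_{v\in A}\mathcal X_v$. A system of constraints $\mathcal M$ consists of independent random variables $X_W=(X_w)_{w\in W}$ with values in $\mathcal X_W$ and, for each $f\in F$, a set $V(f)\subseteq V$, a measurable function $\phi_f:\mathcal X_{V(f)}\to\mathcal Y_f$ and a constant $c_f\in\mathcal Y_f$. Its bipartite graph is $\mathcal B=\langle V,F,E\rangle$ with $E=\{(f-v): v\in V(f)\}$. A solution is a measurable map $g:\mathcal X_W\to\mathcal X_{V\setminus W}$ such that, $\mathbb P_{X_W}$-almost surely, $\phi_f$ takes the value $c_f$ at the $V(f)$-coordinates of $(X_W,g(X_W))$ for all $f\in F$. For $S_F\subseteq F$ put $V(S_F)=\bigcup_{f\in S_F}V(f)$. The system is uniquely solvable with respect to $S_F\subseteq F$ and $S_V\subseteq V(S_F)\setminus W$ if there is a measurable function $h:\mathcal X_{V(S_F)\setminus S_V}\to\mathcal X_{S_V}$ such that, $\mathbb P_{X_W}$-almost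 surely, for all $x\in\mathcal X_{V(S_F)}$ with $x_w=X_w$ for $w\in V(S_F)\cap W$, $$\big(\phi_f(x_{V(f)})=c_f\ \text{ for all } f\in S_F\big)\iff x_{S_V}=h\big(x_{V(S_F)\setminus S_V}\big).$$ Let $M$ be a perfect matching of the subgraph of $\mathcal B$ induced by $(V\setminus W)\cup F$. The directed graph $\mathcal G(\mathcal B,M)$ on $V\cup F$ has an edge $f\to v$ for each $(f-v)\in M$ and an edge $v\to f$ for each $(f-v)\in E\setminus M$. For $S\subseteq V\cup F$ let $M(S)$ be the set of vertices that are matched by $M$ to a vertex in $S$. Let $\mathcal G=\mathcal G(\mathcal B,M)_{\mathrm{mar}(F)}$ be the latent projection of $\mathcal G(\mathcal B,M)$ onto $V$; it has an edge $x\to y$ precisely when $x\to f\to y$ in $\mathcal G(\mathcal B,M)$ for some $f\in F$, and no bidirected edges. A path in $\mathcal G$ is a sequence of distinct vertices $v_1,\dots,v_n$ ($n\ge 1$) together with a chosen edge, in either direction, between each $v_i$ and $v_{i+1}$. It is $\sigma$-blocked by $Z\subseteq V$ if $v_1\in Z$ or $v_n\in Z$; or both edges of the path at some $v_i$ ($1<i<n$)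 have an arrowhead at $v_i$ and there is no directed path (of length $\ge 0$) from $v_i$ to $Z$; or some $v_i\in Z$ has an outgoing edge of the path to a neighbour on the path that is not in the strongly connected component of $v_i$ in $\mathcal G$. Sets $A,B\subseteq V$ are $\sigma$-separated by $Z$ if every path with one end-vertex in $A$ and one in $B$ is $\sigma$-blocked by $Z$. **Theorem.** Let $g$ be a solution of $\mathcal M$, and let $X^*=(X_W,g(X_W))$ be the corresponding family of all variables, with values in $\mathcal X_V$. Suppose that the subgraph of $\mathcal B$ induced by $(V\setminus W)\cup F$ has a perfect matching $M$, and that for every strongly connected component $S$ of $\mathcal G(\mathcal B,M)$ with $S\cap W=\emptyset$ the system is uniquely solvable with respect to the constraints $(S\cup M(S))\cap F$ and the variables $(S\cup M(S))\cap V$. Then $(\mathcal G(\mathcal B,M)_{\mathrm{mar}(F)},\mathbb P_{X^*})$ satisfies the generalized directed global Markov property: for all $A,B,Z\subseteq V$, if $A$ and $B$ are $\sigma$-separated by $Z$ in $\mathcal G(\mathcal B,M)_{\mathrm{mar}(F)}$, then $X^*_A$ and $X^*_B$ are conditionally independent given $X^*_Z$. -/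

import Mathlib

open MeasureTheory ProbabilityTheory

noncomputable section

/-! ### Directed mixed graphs -/

/-- A directed mixed graph on the vertex set `N`: directed edges `a → b` and bidirected edges
`a ↔ b`. A directed graph is one without bidirected edges. -/
structure MixedGraph (N : Type*) where
  /-- `dir a b` is the directed edge `a → b`. -/
  dir : N → N → Prop
  /-- `bidir a b` is the bidirected edge `a ↔ b`. -/
  bidir : N → N → Prop
  bidir_symm : ∀ a b, bidir a b → bidir b a

/-- The three kinds of edges between consecutive vertices `a, b` of a path. -/
inductive EdgeKind where
  /-- `a → b` -/
  | fwd
  /-- `a ← b` -/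
  | bwd
  /-- `a ↔ b` -/
  | both

/-- The edge between consecutive vertices `a, b` has an arrowhead at `a`. -/
def EdgeKind.HeadAtFirst (k : EdgeKind) : Prop := k = .bwd ∨ k = .both

/-- The edge between consecutive vertices `a, b` has an arrowhead at `b`. -/
def EdgeKind.HeadAtSecond (k : EdgeKind) : Prop := k = .fwd ∨ k = .both

namespace MixedGraph

variable {N : Type*} (G : MixedGraph N)

/-- There is a directed path (possibly of length zero) from `a` to `b`. -/
def Reaches (a b : N) : Prop := Relation.ReflTransGen G.dir a b

/-- The set of ancestors of the vertices in `Z` (which includes `Z` itself). -/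
def ancestors (Z : Set N) : Set N := {a | ∃ z ∈ Z, G.Reaches a z}

/-- The strongly connected component of `a`: the vertices that are both ancestors and
descendants of `a`. -/
def scc (a : N) : Set N := {b | G.Reaches b a ∧ G.Reaches a b}

/-- The graph has an edge of kind `k` between `a` and `b` (read from `a` to `b`). -/
def HasEdge : EdgeKind → N → N → Prop
  | .fwd, a, b => G.dir a b
  | .bwd, a, b => G.dir b a
  | .both, a, b => G.bidir a b

/-- `v 0, e 0, v 1, e 1, …, e (n - 1), v n` is a path: a sequence of pairwise distinct vertices
such that `e i` is an edge between `v i` and `v (i + 1)`. The path `v 0` without edges is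
allowed. The values `v i` for `n < i` and `e i` for `n ≤ i` play no role. -/
structure IsPath (n : ℕ) (v : ℕ → N) (e : ℕ → EdgeKind) : Prop where
  distinct : ∀ i ≤ n, ∀ j ≤ n, v i = v j → i = j
  edges : ∀ i < n, G.HasEdge (e i) (v i) (v (i + 1))

/-- The path is σ-blocked by `Z`: an end-vertex is in `Z`; or there is a collider that is not an
ancestor of `Z`; or there is a vertex in `Z` from which an edge of the path points to a
neighbour on the path in another strongly connected component. -/
def SigmaBlocked (Z : Set N) (n : ℕ) (v : ℕ → N) (e : ℕ → EdgeKind) : Prop :=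
  (v 0 ∈ Z ∨ v n ∈ Z) ∨
  (∃ i, i + 1 < n ∧ (e i).HeadAtSecond ∧ (e (i + 1)).HeadAtFirst ∧
    v (i + 1) ∉ G.ancestors Z) ∨
  (∃ i < n, (e i = .fwd ∧ v i ∈ Z ∧ v (i + 1) ∉ G.scc (v i)) ∨
    (e i = .bwd ∧ v (i + 1) ∈ Z ∧ v i ∉ G.scc (v (i + 1))))

/-- `A` and `B` are σ-separated by `Z`: every path between a vertex of `A` and a vertex of `B` is
σ-blocked by `Z`. -/
def SigmaSeparated (A B Z : Set N) : Prop :=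
  ∀ (n : ℕ) (v : ℕ → N) (e : ℕ → EdgeKind), G.IsPath n v e → v 0 ∈ A → v n ∈ B →
    G.SigmaBlocked Z n v e

section Marginalization

variable {V F : Type*} (H : MixedGraph (V ⊕ F))

/-- `a → f₁ → ⋯ → fₖ → b` in `H` for some `f₁, …, fₖ` in `F`, with `0 ≤ k`. -/
def DirectedThrough (a b : V ⊕ F) : Prop :=
  ∃ c, Relation.ReflTransGen (fun p q => H.dir p q ∧ q.isRight) a c ∧ H.dir c b

/-- `a` is `x` itself, or `a` is in `F` and there is a directed path from `a` to `x` on which all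
vertices but `x` are in `F`. -/
def LatentSource (a : V ⊕ F) (x : V) : Prop :=
  a = Sum.inl x ∨ (a.isRight ∧ H.DirectedThrough a (Sum.inl x))

/-- Marginalizing out the vertices in `F` (the latent projection onto `V`). There is an edge
`x → y` if `H` has a directed path from `x` to `y` with intermediate vertices in `F`; there is an
edge `x ↔ y` if `x ≠ y` and `H` has a path `x ← ⋯ ← f → ⋯ → y` or `x ← ⋯ ← a ↔ b → ⋯ → y` with
intermediate vertices in `F` (where `a = x` and `b = y` are allowed). -/
def marginalize : MixedGraph V where
  dir x y := H.DirectedThrough (Sum.inl x) (Sum.inl y)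
  bidir x y := x ≠ y ∧ ∃ a b, ((a = b ∧ a.isRight) ∨ H.bidir a b) ∧
    H.LatentSource a x ∧ H.LatentSource b y
  bidir_symm := by
    rintro x y ⟨hxy, a, b, h, ha, hb⟩
    refine ⟨hxy.symm, b, a, ?_, hb, ha⟩
    rcases h with ⟨rfl, h⟩ | h
    · exact Or.inl ⟨rfl, h⟩
    · exact Or.inr (H.bidir_symm _ _ h)

end Marginalization

/-- The projection of a tuple onto the coordinates in `A`. -/
def coords {V : Type*} {𝒳 : V → Type*} (A : Set V) (x : ∀ v, 𝒳 v) : ∀ v : A, 𝒳 v := fun v => x v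

theorem measurable_coords {V : Type*} {𝒳 : V → Type*} [∀ v, MeasurableSpace (𝒳 v)] (A : Set V) :
    Measurable (coords (𝒳 := 𝒳) A) :=
  measurable_pi_lambda _ fun v => measurable_pi_apply v.1

/-- The generalized directed global Markov property of a graph and a distribution on the product
`∏ v, 𝒳 v`: if `A` and `B` are σ-separated by `Z`, then the coordinates in `A` and those in `B`
are conditionally independent given those in `Z`. -/
def GeneralizedMarkov {V : Type*} [Finite V] (G : MixedGraph V) {𝒳 : V → Type*}
    [∀ v, MeasurableSpace (𝒳 v)] [∀ v, StandardBorelSpace (𝒳 v)]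
    (μ : Measure (∀ v, 𝒳 v)) [IsFiniteMeasure μ] : Prop :=
  ∀ A B Z : Set V, G.SigmaSeparated A B Z →
    CondIndepFun (MeasurableSpace.comap (coords (𝒳 := 𝒳) Z) inferInstance)
      (measurable_coords Z).comap_le (coords (𝒳 := 𝒳) A) (coords (𝒳 := 𝒳) B) μ

end MixedGraph

/-! ### Systems of constraints -/

/-- A system of constraints with variables `v : V` taking values in `𝒳 v` and constraints `f : F`
with values in `𝒴 f`. The exogenous variables are random variables on `(Ω, P)`. -/
structure ConstraintSystem {V F Ω : Type*} (𝒳 : V → Type*) (𝒴 : F → Type*)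
    [∀ v, MeasurableSpace (𝒳 v)] [∀ f, MeasurableSpace (𝒴 f)] [MeasurableSpace Ω]
    (P : Measure Ω) where
  /-- The set `W` of exogenous variables. -/
  W : Set V
  /-- The exogenous random variables `X_w`. -/
  exo : ∀ w : W, Ω → 𝒳 w
  measurable_exo : ∀ w, Measurable (exo w)
  indep_exo : iIndepFun exo P
  /-- The set `V(f)` of variables that appear in the constraint `f`. -/
  vars : F → Set V
  /-- The function `φ_f` of the constraint `f`. -/
  φ : ∀ f, (∀ v : vars f, 𝒳 v) → 𝒴 f
  measurable_φ : ∀ f, Measurable (φ f)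
  /-- The constant `c_f` of the constraint `f`. -/
  c : ∀ f, 𝒴 f

namespace ConstraintSystem

variable {V F Ω : Type*} {𝒳 : V → Type*} {𝒴 : F → Type*}
  [∀ v, MeasurableSpace (𝒳 v)] [∀ f, MeasurableSpace (𝒴 f)] [MeasurableSpace Ω]
  {P : Measure Ω} (M : ConstraintSystem 𝒳 𝒴 P)

/-- The joint distribution of the exogenous variables. -/
def exoLaw : Measure (∀ w : M.W, 𝒳 w) := P.map (fun ω w => M.exo w ω)

open Classical in
/-- The values of all variables, from those of the exogenous and of the endogenous ones. -/
def combine (xW : ∀ w : M.W, 𝒳 w) (y : ∀ v : (M.Wᶜ : Set V), 𝒳 v) (v : V) : 𝒳 v :=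
  if h : v ∈ M.W then xW ⟨v, h⟩ else y ⟨v, h⟩

theorem measurable_combine {g : (∀ w : M.W, 𝒳 w) → ∀ v : (M.Wᶜ : Set V), 𝒳 v}
    (hg : Measurable g) : Measurable fun xW => M.combine xW (g xW) := by
  refine measurable_pi_lambda _ fun v => ?_
  by_cases h : v ∈ M.W
  · simpa [combine, h] using measurable_pi_apply (⟨v, h⟩ : M.W)
  · simpa only [combine, h, dite_false] using
      (measurable_pi_iff.1 hg (⟨v, h⟩ : (M.Wᶜ : Set V)))

/-- `g` is a solution: a measurable map from the exogenous to the endogenous values such that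
almost surely all constraints hold. -/
def IsSolution (g : (∀ w : M.W, 𝒳 w) → ∀ v : (M.Wᶜ : Set V), 𝒳 v) : Prop :=
  Measurable g ∧ ∀ᵐ xW ∂M.exoLaw, ∀ f, M.φ f (fun v => M.combine xW (g xW) v) = M.c f

/-- The joint distribution of all variables (exogenous and endogenous) under the solution `g`. -/
def solutionLaw (g : (∀ w : M.W, 𝒳 w) → ∀ v : (M.Wᶜ : Set V), 𝒳 v) : Measure (∀ v, 𝒳 v) :=
  M.exoLaw.map fun xW => M.combine xW (g xW)

instance isFiniteMeasure_solutionLaw [IsProbabilityMeasure P]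
    (g : (∀ w : M.W, 𝒳 w) → ∀ v : (M.Wᶜ : Set V), 𝒳 v) :
    IsFiniteMeasure (M.solutionLaw g) := by
  unfold solutionLaw exoLaw
  infer_instance

/-- The variables `V(S_F)` that appear in some constraint in `SF`. -/
def varsOf (SF : Set F) : Set V := ⋃ f ∈ SF, M.vars f

/-- Unique solvability with respect to the constraints `SF` and the endogenous variables
`SV ⊆ V(SF) \ W`: there is a measurable `g` such that, for almost every value `xW` of the
exogenous variables and every tuple `x` of values of the variables `V(SF)` that extends `xW`,
the constraints in `SF` hold at `x` if and only if `x_SV = g (x_{V(SF) \ SV})`. -/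
def UniquelySolvable (SF : Set F) (SV : Set V) : Prop :=
  ∃ hSV : SV ⊆ M.varsOf SF \ M.W,
  ∃ g : (∀ v : (M.varsOf SF \ SV : Set V), 𝒳 v) → ∀ v : SV, 𝒳 v, Measurable g ∧
    ∀ᵐ xW ∂M.exoLaw, ∀ x : ∀ v : M.varsOf SF, 𝒳 v,
      (∀ (v : M.varsOf SF) (hv : v.1 ∈ M.W), x v = xW ⟨v, hv⟩) →
      ((∀ f, ∀ hf : f ∈ SF, M.φ f (fun v => x ⟨v, Set.mem_biUnion hf v.2⟩) = M.c f) ↔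
        (fun v : SV => x ⟨v, (hSV v.2).1⟩) = g (fun v => x ⟨v, v.2.1⟩))

/-- `m` is a perfect matching of the subgraph of the bipartite graph `⟨V, F, {(v, f) | v ∈ V(f)}⟩`
that is induced by the endogenous variables and the constraints. -/
structure IsPerfectMatching (m : Set (V × F)) : Prop where
  edge : ∀ v f, (v, f) ∈ m → v ∈ M.vars f ∧ v ∉ M.W
  variable_matched : ∀ v, v ∉ M.W → ∃! f, (v, f) ∈ m
  constraint_matched : ∀ f, ∃! v, (v, f) ∈ m

/-- The directed graph associated with the bipartite graph and the matching `m`: an edge between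
`v` and `f` is oriented `f → v` if it is in `m`, and `v → f` otherwise. -/
def orient (m : Set (V × F)) : MixedGraph (V ⊕ F) where
  dir
    | .inl v, .inr f => v ∈ M.vars f ∧ (v, f) ∉ m
    | .inr f, .inl v => v ∈ M.vars f ∧ (v, f) ∈ m
    | _, _ => False
  bidir _ _ := False
  bidir_symm _ _ h := h

end ConstraintSystem

/-- The set of vertices to which the vertices in `S` are matched by `m`. -/
def matchedTo {V F : Type*} (m : Set (V × F)) (S : Set (V ⊕ F)) : Set (V ⊕ F) :=
  {x | ∃ v f, (v, f) ∈ m ∧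
    ((x = Sum.inl v ∧ Sum.inr f ∈ S) ∨ (x = Sum.inr f ∧ Sum.inl v ∈ S))}

end

/-! Unique solvability says that, almost surely, the variables of a strongly connected component of
endogenous variables are a function of the component's parents (`exists_coords_scc_eq`). Together
with independence of the exogenous variables, this is all the probability that the Markov property
needs.

σ-separation is first extended from paths to walks, because the constructions below may revisit
vertices: a shortest σ-open walk is a path (`exists_injective_openWalk`). Then
`WalkSeparated.coordCondIndep` inducts on the size of an ancestral set D containing W. If D is W,
the claim is independence. Otherwise take a component C outside W that no edge leaves within D.

If Z misses C, the members of C in A or in B are replaced by the parents of C outside Z. This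
preserves separation (`parents_left`, `parents_right`) and loses no information (`of_coords_eq`), so
D can shrink to D \ C.

If Z meets C, condition on Z \ C instead. Every vertex of C is an ancestor of Z, so open walks to C
from both sides could be joined through C; hence one side is separated from C. Adjoin C to the other
side, apply the first case, and return Z ∩ C to the conditioning set by weak union. -/

/-! ### Conditional independence of σ-algebras. -/

section CondIndep

variable {Ω : Type*} {m' m₁ m₂ m₃ mΩ : MeasurableSpace Ω} {μ : Measure Ω} [IsFiniteMeasure μ]

theorem generateFrom_inter_eq_sup (m₁ m₂ : MeasurableSpace Ω) :
    m₁ ⊔ m₂ = MeasurableSpace.generateFrom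
      {u | ∃ s t, MeasurableSet[m₁] s ∧ MeasurableSet[m₂] t ∧ u = s ∩ t} := by
  refine le_antisymm (sup_le ?_ ?_) (MeasurableSpace.generateFrom_le ?_)
  · exact fun s hs => MeasurableSpace.measurableSet_generateFrom
      ⟨s, Set.univ, hs, MeasurableSet.univ, by simp⟩
  · exact fun s hs => MeasurableSpace.measurableSet_generateFrom
      ⟨Set.univ, s, MeasurableSet.univ, hs, by simp⟩
  · rintro _ ⟨s, t, hs, ht, rfl⟩
    exact MeasurableSet.inter ((le_sup_left : m₁ ≤ m₁ ⊔ m₂) _ hs)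
      ((le_sup_right : m₂ ≤ m₁ ⊔ m₂) _ ht)

theorem isPiSystem_inter (m₁ m₂ : MeasurableSpace Ω) :
    IsPiSystem {u | ∃ s t, MeasurableSet[m₁] s ∧ MeasurableSet[m₂] t ∧ u = s ∩ t} := by
  rintro _ ⟨s, t, hs, ht, rfl⟩ _ ⟨s', t', hs', ht', rfl⟩ -
  exact ⟨s ∩ s', t ∩ t', hs.inter hs', ht.inter ht', Set.inter_inter_inter_comm _ _ _ _⟩

theorem integrable_indicator_one {s : Set Ω} (hs : MeasurableSet s) :
    Integrable (s.indicator fun _ => (1 : ℝ)) μ :=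
  (integrable_const 1).indicator hs

theorem condExp_inter_ae_eq {s r : Set Ω} (hs : MeasurableSet s)
    (hr : MeasurableSet[m'] r) : μ⟦s ∩ r|m'⟧ =ᵐ[μ] r.indicator (μ⟦s|m'⟧) := by
  have : (s ∩ r).indicator (fun _ => (1 : ℝ)) = r.indicator (s.indicator fun _ => (1 : ℝ)) := by
    rw [Set.indicator_indicator, Set.inter_comm]
  rw [this]
  exact condExp_indicator (integrable_indicator_one hs) hr

theorem condExp_indicator_mul {s t : Set Ω} (hs : MeasurableSet s) :
    μ[s.indicator (μ⟦t|m'⟧) | m'] =ᵐ[μ] μ⟦s|m'⟧ * μ⟦t|m'⟧ := by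
  have : s.indicator (μ⟦t|m'⟧) = (s.indicator fun _ => (1 : ℝ)) * μ⟦t|m'⟧ := by
    ext x
    by_cases hx : x ∈ s <;> simp [hx]
  rw [this]
  refine condExp_mul_of_stronglyMeasurable_right stronglyMeasurable_condExp ?_
    (integrable_indicator_one hs)
  rw [← this]
  exact integrable_condExp.indicator hs

variable [StandardBorelSpace Ω]

/-- Intersections of an event of `m₁` with an event of `m'` form a generating π-system of the join,
and the indicator of the second event pulls out of the conditional expectations. -/
theorem ProbabilityTheory.CondIndep.sup_left (hm' : m' ≤ mΩ) (h₁ : m₁ ≤ mΩ) (h₂ : m₂ ≤ mΩ)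
    (h : CondIndep m' m₁ m₂ hm' μ) : CondIndep m' (m₁ ⊔ m') m₂ hm' μ := by
  refine CondIndepSets.condIndep (sup_le h₁ hm') h₂ (isPiSystem_inter m₁ m')
    (@MeasurableSpace.isPiSystem_measurableSet _ m₂) (generateFrom_inter_eq_sup m₁ m')
    (@MeasurableSpace.generateFrom_measurableSet _ m₂).symm ?_
  rw [condIndepSets_iff]
  rotate_left
  · rintro _ ⟨s, t, hs, ht, rfl⟩
    exact (h₁ _ hs).inter (hm' _ ht)
  · exact fun s hs => h₂ _ hs
  rintro _ t ⟨s, r, hs, hr, rfl⟩ ht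
  rw [condIndep_iff _ _ _ hm' h₁ h₂] at h
  have e : s ∩ r ∩ t = (s ∩ t) ∩ r := Set.inter_right_comm _ _ _
  rw [e]
  filter_upwards [h s t hs ht, condExp_inter_ae_eq (μ := μ) ((h₁ _ hs).inter (h₂ _ ht)) hr,
    condExp_inter_ae_eq (μ := μ) (h₁ _ hs) hr] with x h1 h2 h3
  rw [h2, Pi.mul_apply, h3]
  by_cases hx : x ∈ r <;> simp [hx, h1]

/-- Conditional independence in terms of conditional probabilities: adding `m₁` to the
conditioning σ-algebra does not change the conditional probabilities of the events in `m₂`. -/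
theorem condIndep_iff_condExp_sup (hm' : m' ≤ mΩ) (h₁ : m₁ ≤ mΩ) (h₂ : m₂ ≤ mΩ) :
    CondIndep m' m₁ m₂ hm' μ ↔
      ∀ t, MeasurableSet[m₂] t → μ⟦t|m₁ ⊔ m'⟧ =ᵐ[μ] μ⟦t|m'⟧ := by
  have hsup : m₁ ⊔ m' ≤ mΩ := sup_le h₁ hm'
  constructor
  · intro h t ht
    have h' := h.sup_left hm' h₁ h₂
    have hf : StronglyMeasurable[m₁ ⊔ m'] (μ⟦t|m'⟧) :=
      stronglyMeasurable_condExp.mono le_sup_right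
    rw [condIndep_iff _ _ _ hm' hsup h₂] at h'
    -- The conditional probability given `m'` has the right integrals over all sets of `m₁ ⊔ m'`, by
    -- the product formula for the enlarged left side.
    refine (ae_eq_condExp_of_forall_setIntegral_eq hsup (integrable_indicator_one (h₂ _ ht))
      (fun s _ _ => integrable_condExp.integrableOn) (fun s hs _ => ?_)
      hf.aestronglyMeasurable).symm
    rw [← integral_indicator (hsup _ hs), ← integral_condExp hm',
      integral_congr_ae ((condExp_indicator_mul (hsup _ hs)).trans (h' s t hs ht).symm),
      integral_condExp hm', ← integral_indicator (hsup _ hs), Set.indicator_indicator]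
  · intro h
    rw [condIndep_iff _ _ _ hm' h₁ h₂]
    intro s t hs ht
    refine Filter.EventuallyEq.trans ?_ (condExp_indicator_mul (h₁ _ hs))
    refine (condExp_condExp_of_le (le_sup_right : m' ≤ m₁ ⊔ m') hsup).symm.trans ?_
    refine condExp_congr_ae ?_
    rw [Set.inter_comm]
    have hs' : MeasurableSet[m₁ ⊔ m'] s := (le_sup_left : m₁ ≤ m₁ ⊔ m') _ hs
    filter_upwards [condExp_inter_ae_eq (μ := μ) (h₂ _ ht) hs', h t ht] with x h1 h2
    rw [h1]
    by_cases hx : x ∈ s <;> simp [hx, h2]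

/-- Weak union. -/
theorem ProbabilityTheory.CondIndep.weak_union (hm' : m' ≤ mΩ)
    (h₁ : m₁ ≤ mΩ) (h₂ : m₂ ≤ mΩ) (h₃ : m₃ ≤ mΩ) (h : CondIndep m' (m₁ ⊔ m₃) m₂ hm' μ) :
    CondIndep (m₃ ⊔ m') m₁ m₂ (sup_le h₃ hm') μ := by
  rw [condIndep_iff_condExp_sup _ (sup_le h₁ h₃) h₂] at h
  rw [condIndep_iff_condExp_sup _ h₁ h₂]
  intro t ht
  have hle : m₃ ⊔ m' ≤ m₁ ⊔ m₃ ⊔ m' := sup_le_sup_right le_sup_right _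
  have hle' : m₁ ⊔ m₃ ⊔ m' ≤ mΩ := sup_le (sup_le h₁ h₃) hm'
  rw [← sup_assoc]
  -- The conditional probability given the largest σ-algebra is already `m'`-measurable, so
  -- conditioning it on the intermediate `m₃ ⊔ m'` leaves it fixed; the tower property finishes.
  refine (h t ht).trans (Filter.EventuallyEq.trans ?_ (condExp_condExp_of_le hle hle'))
  refine Filter.EventuallyEq.trans ?_ (condExp_congr_ae (h t ht)).symm
  rw [condExp_of_stronglyMeasurable (sup_le h₃ hm')
    (stronglyMeasurable_condExp.mono le_sup_right) integrable_condExp]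

/-- Conditional probabilities depend only on events modulo null sets. This allows variables to be
replaced by others that determine them almost surely. -/
theorem ProbabilityTheory.CondIndep.of_ae_eq_left (hm' : m' ≤ mΩ)
    (h₁ : m₁ ≤ mΩ) (h₂ : m₂ ≤ mΩ) (h₃ : m₃ ≤ mΩ) (h : CondIndep m' m₁ m₂ hm' μ)
    (hae : ∀ s, MeasurableSet[m₃] s → ∃ t, MeasurableSet[m₁] t ∧ s =ᵐ[μ] t) :
    CondIndep m' m₃ m₂ hm' μ := by
  rw [condIndep_iff _ _ _ hm' h₁ h₂] at h
  rw [condIndep_iff _ _ _ hm' h₃ h₂]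
  intro s t hs ht
  obtain ⟨s', hs', hss'⟩ := hae s hs
  have h1 : μ⟦s ∩ t|m'⟧ =ᵐ[μ] μ⟦s' ∩ t|m'⟧ :=
    condExp_congr_ae (indicator_ae_eq_of_ae_eq_set (hss'.inter (ae_eq_refl t)))
  have h2 : μ⟦s|m'⟧ =ᵐ[μ] μ⟦s'|m'⟧ := condExp_congr_ae (indicator_ae_eq_of_ae_eq_set hss')
  exact h1.trans ((h s' t hs' ht).trans (h2.symm.mul (ae_eq_refl _)))

/-- Independence is conditional independence given the trivial σ-algebra. -/
theorem condIndep_bot_of_indep [IsProbabilityMeasure μ] (h₁ : m₁ ≤ mΩ) (h₂ : m₂ ≤ mΩ)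
    (h : Indep m₁ m₂ μ) : CondIndep ⊥ m₁ m₂ bot_le μ := by
  rw [condIndep_iff _ _ _ bot_le h₁ h₂]
  intro s t hs ht
  simp only [condExp_bot]
  refine Filter.Eventually.of_forall fun x => ?_
  simp only [Pi.mul_apply]
  rw [integral_indicator_const _ ((h₁ _ hs).inter (h₂ _ ht)), integral_indicator_const _ (h₁ _ hs),
    integral_indicator_const _ (h₂ _ ht)]
  simp [Measure.real, (Indep_iff _ _ _).1 h s t hs ht]

end CondIndep

namespace MixedGraph

/-! ### σ-open walks and their reduction to paths. -/

section Walks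

variable {N : Type*} (G : MixedGraph N) {Z D : Set N}

/-- A step of a σ-open walk within `D` along a directed edge, in either direction. The Boolean
records whether the last edge of the walk so far has an arrowhead at the current vertex. -/
inductive OpenStep (Z D : Set N) : N × Bool → N × Bool → Prop
  | fwd {a b : N} (s : Bool) (ha : a ∈ D) (hb : b ∈ D) (h : G.dir a b)
      (hZ : a ∈ Z → b ∈ G.scc a) : OpenStep Z D (a, s) (b, true)
  | bwd {a b : N} (s : Bool) (ha : a ∈ D) (hb : b ∈ D) (h : G.dir b a)
      (hs : s = true → a ∈ G.ancestors Z) (hZ : b ∈ Z → a ∈ G.scc b) :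
      OpenStep Z D (a, s) (b, false)

/-- There is a σ-open walk within `D` from `a` to `b`, apart from the requirement that the
end-vertices are not in `Z`. -/
def OpenWalk (Z D : Set N) (a b : N) : Prop :=
  -- The initial flag `false` exempts the first vertex from the collider test.
  ∃ s, Relation.ReflTransGen (G.OpenStep Z D) (a, false) (b, s)

/-- No σ-open walk within `D` connects a vertex of `A` and a vertex of `B`. -/
def WalkSeparated (D A B Z : Set N) : Prop :=
  ∀ a ∈ A, ∀ b ∈ B, a ∉ Z → b ∉ Z → ¬ G.OpenWalk Z D a b

variable {G}

theorem mem_ancestors_of_dir {a b : N} (h : G.dir a b) (hb : b ∈ G.ancestors Z) :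
    a ∈ G.ancestors Z := by
  obtain ⟨z, hz, hbz⟩ := hb
  exact ⟨z, hz, Relation.ReflTransGen.head h hbz⟩

/-- A walk that enters `x` by an arrowhead and leaves its last vertex by a tail has a collider
that descends from `x`. -/
theorem mem_ancestors_of_open {p q : N × Bool}
    (h : Relation.ReflTransGen (G.OpenStep Z D) p q) (hq : q.2 = false) (hp : p.2 = true) :
    p.1 ∈ G.ancestors Z := by
  induction h using Relation.ReflTransGen.head_induction_on with
  | refl => simp [hq] at hp
  | head hstep _ ih =>
    cases hstep with
    | fwd s ha hb h hZ => exact mem_ancestors_of_dir h (ih rfl)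
    | bwd s ha hb h hs hZ => exact hs hp

/-- A step can be taken from another walk that ends in the same vertex, provided that this does
not create a closed collider. -/
theorem OpenStep.change_state {a : N} {s : Bool} {q : N × Bool} (h : G.OpenStep Z D (a, s) q)
    (t : Bool) (ht : s = false → t = true → a ∈ G.ancestors Z) : G.OpenStep Z D (a, t) q := by
  cases h with
  | fwd _ ha hb h hZ => exact .fwd t ha hb h hZ
  | bwd _ ha hb h hs hZ =>
    refine .bwd t ha hb h (fun h' => ?_) hZ
    cases s
    · exact ht rfl h'
    · exact hs rfl

/-- The non-collider conditions belong to single edges, so joining two open walks can fail only by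
creating a collider at the junction, which is harmless at an ancestor of `Z`. -/
theorem openWalk_trans_of_mem_ancestors {a b : N} {p : N × Bool} {s : Bool}
    (hp : Relation.ReflTransGen (G.OpenStep Z D) p (a, s)) (ha : a ∈ G.ancestors Z)
    (h : G.OpenWalk Z D a b) : ∃ t, Relation.ReflTransGen (G.OpenStep Z D) p (b, t) := by
  obtain ⟨t, h⟩ := h
  rcases Relation.ReflTransGen.cases_head h with h | ⟨q, h1, h2⟩
  · cases h
    exact ⟨_, hp⟩
  · exact ⟨t, (hp.tail (h1.change_state s fun _ _ => ha)).trans h2⟩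

theorem exists_seq_of_reflTransGen {α : Type*} {r : α → α → Prop} {a b : α}
    (h : Relation.ReflTransGen r a b) :
    ∃ (n : ℕ) (f : ℕ → α), f 0 = a ∧ f n = b ∧ ∀ i < n, r (f i) (f (i + 1)) := by
  induction h with
  | refl => exact ⟨0, fun _ => a, rfl, rfl, by simp⟩
  | @tail b c _ hbc ih =>
    obtain ⟨n, f, h0, hn, hf⟩ := ih
    refine ⟨n + 1, fun i => if i ≤ n then f i else c, by simp [h0], by simp, fun i hi => ?_⟩
    rcases Nat.lt_succ_iff_lt_or_eq.1 hi with h | rfl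
    · simpa [h.le, Nat.succ_le_of_lt h] using hf i h
    · simpa [hn] using hbc

theorem reflTransGen_of_seq {α : Type*} {r : α → α → Prop} {n : ℕ} {f : ℕ → α}
    (h : ∀ i < n, r (f i) (f (i + 1))) {i j : ℕ} (hij : i ≤ j) (hj : j ≤ n) :
    Relation.ReflTransGen r (f i) (f j) := by
  induction j, hij using Nat.le_induction with
  | base => exact .refl
  | succ k hk ih => exact (ih (by omega)).tail (h k (by omega))

/-- A shortest open walk has no repeated vertices. -/
theorem exists_injective_openWalk {a b : N} (h : G.OpenWalk Z D a b) :
    ∃ (n : ℕ) (f : ℕ → N × Bool), f 0 = (a, false) ∧ (f n).1 = b ∧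
      (∀ i < n, G.OpenStep Z D (f i) (f (i + 1))) ∧
      ∀ i ≤ n, ∀ j ≤ n, (f i).1 = (f j).1 → i = j := by
  classical
  have hex : ∃ (n : ℕ) (f : ℕ → N × Bool), f 0 = (a, false) ∧ (f n).1 = b ∧
      ∀ i < n, G.OpenStep Z D (f i) (f (i + 1)) := by
    obtain ⟨s, h⟩ := h
    obtain ⟨n, f, h0, hn, hf⟩ := exists_seq_of_reflTransGen h
    exact ⟨n, f, h0, by rw [hn], hf⟩
  obtain ⟨f, h0, hn, hf⟩ := Nat.find_spec hex
  set n := Nat.find hex with hn_def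
  refine ⟨n, f, h0, hn, hf, ?_⟩
  have key : ∀ i j, i < j → j ≤ n → (f i).1 ≠ (f j).1 := by
    intro i j hij hjn heq
    rcases hjn.lt_or_eq with hj | hj
    · have hlt : n - (j - i) < Nat.find hex := by omega
      -- Excise the loop between the two visits; the result is shorter by `j - i`.
      refine Nat.find_min hex hlt
        ⟨fun k => if k ≤ i then f k else f (k + (j - i)), by simp [h0], ?_, fun k hk => ?_⟩
      · have h1 : ¬ n - (j - i) ≤ i := by omega
        have h2 : n - (j - i) + (j - i) = n := by omega
        simp only [h1, if_false, h2, hn]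
      · rcases lt_trichotomy k i with hki | rfl | hki
        · simpa [hki.le, Nat.succ_le_of_lt hki] using hf k (by omega)
        · have e : k + 1 + (j - k) = j + 1 := by omega
          simp only [le_refl, if_true, Nat.not_succ_le_self, if_false, e]
          have hstep := hf j hj
          have e1 : f j = ((f k).1, (f j).2) := by rw [heq]
          rw [e1] at hstep
          -- A new collider arises only if the loop was entered by an arrowhead and its return was
          -- by a tail; then the loop itself shows that the vertex is an ancestor of `Z`.
          refine hstep.change_state (f k).2 fun h1 h2 => ?_
          exact mem_ancestors_of_open (reflTransGen_of_seq hf hij.le hj.le) h1 h2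
        · have e1 : ¬ k ≤ i := by omega
          have e2 : ¬ k + 1 ≤ i := by omega
          have e3 : k + 1 + (j - i) = k + (j - i) + 1 := by omega
          simp only [e1, e2, if_false, e3]
          exact hf _ (by omega)
    -- The final flag is free, so a walk already at its end vertex can stop there.
    · refine Nat.find_min hex (m := i) (by omega) ⟨f, h0, ?_, fun k hk => hf k (by omega)⟩
      rw [heq, hj, hn]
  intro i hi j hj heq
  rcases lt_trichotomy i j with h | h | h
  · exact absurd heq (key i j h hj)
  · exact h
  · exact absurd heq.symm (key j i h hi)

/-- A shortest open walk is a path, and the step conditions refute each way of being σ-blocked. The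
flag after a step determines the direction of its edge. -/
theorem SigmaSeparated.walkSeparated {A B : Set N} (h : G.SigmaSeparated A B Z) :
    G.WalkSeparated Set.univ A B Z := by
  classical
  intro a ha b hb haZ hbZ hw
  obtain ⟨n, f, h0, hn, hf, hinj⟩ := exists_injective_openWalk hw
  have hfwd : ∀ i < n, (f (i + 1)).2 = true → G.dir (f i).1 (f (i + 1)).1 ∧
      ((f i).1 ∈ Z → (f (i + 1)).1 ∈ G.scc (f i).1) := by
    intro i hi h1
    have := hf i hi
    generalize f i = p at *
    generalize f (i + 1) = q at *
    cases this with
    | fwd s ha hb h hZ => exact ⟨h, hZ⟩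
    | bwd s ha hb h hs hZ => simp at h1
  have hbwd : ∀ i < n, (f (i + 1)).2 = false → G.dir (f (i + 1)).1 (f i).1 ∧
      ((f i).2 = true → (f i).1 ∈ G.ancestors Z) ∧
      ((f (i + 1)).1 ∈ Z → (f i).1 ∈ G.scc (f (i + 1)).1) := by
    intro i hi h1
    have := hf i hi
    generalize f i = p at *
    generalize f (i + 1) = q at *
    cases this with
    | fwd s ha hb h hZ => simp at h1
    | bwd s ha hb h hs hZ => exact ⟨h, hs, hZ⟩
  have hsep := h n (fun i => (f i).1)
    (fun i => if (f (i + 1)).2 = true then EdgeKind.fwd else EdgeKind.bwd)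
    ⟨hinj, fun i hi => ?_⟩ (by simpa [h0] using ha) (by simpa [hn] using hb)
  · rcases hsep with (h1 | h1) | ⟨i, hi, h1, h2, h3⟩ | ⟨i, hi, ⟨h1, h2, h3⟩ | ⟨h1, h2, h3⟩⟩
    · exact haZ (by simpa [h0] using h1)
    · exact hbZ (by simpa [hn] using h1)
    · have e1 : (f (i + 1)).2 = true := by
        by_contra hne
        simp [EdgeKind.HeadAtSecond, hne] at h1
      have e2 : (f (i + 1 + 1)).2 = false := by
        by_contra hne
        rw [Bool.not_eq_false] at hne
        simp [EdgeKind.HeadAtFirst, hne] at h2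
      exact h3 ((hbwd (i + 1) hi e2).2.1 e1)
    · have e1 : (f (i + 1)).2 = true := by
        by_contra hne
        simp [hne] at h1
      exact h3 ((hfwd i hi e1).2 h2)
    · have e1 : (f (i + 1)).2 = false := by
        by_contra hne
        simp [hne] at h1
      exact h3 ((hbwd i hi e1).2.2 h2)
  · by_cases h1 : (f (i + 1)).2 = true
    · simpa [h1, HasEdge] using (hfwd i hi h1).1
    · simpa [h1, HasEdge] using (hbwd i hi (by simpa using h1)).1

end Walks

/-! ### Walks and strongly connected components. -/

section Components

variable {N : Type*} {G : MixedGraph N} {Z Z' D D' : Set N}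

theorem self_mem_scc (v : N) : v ∈ G.scc v := ⟨.refl, .refl⟩

theorem scc_symm {u v : N} (h : u ∈ G.scc v) : v ∈ G.scc u := ⟨h.2, h.1⟩

theorem scc_trans {u v w : N} (h : u ∈ G.scc v) (h' : v ∈ G.scc w) : u ∈ G.scc w :=
  ⟨h.1.trans h'.1, h'.2.trans h.2⟩

theorem OpenStep.mono {p q : N × Bool} (h : G.OpenStep Z D p q) (hD : D ⊆ D') :
    G.OpenStep Z D' p q := by
  cases h with
  | fwd s ha hb h hZ => exact .fwd s (hD ha) (hD hb) h hZ
  | bwd s ha hb h hs hZ => exact .bwd s (hD ha) (hD hb) h hs hZ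

theorem OpenWalk.mono {a b : N} (h : G.OpenWalk Z D a b) (hD : D ⊆ D') : G.OpenWalk Z D' a b :=
  h.imp fun _ h => Relation.ReflTransGen.mono (fun _ _ h => h.mono hD) _ _ h

/-- Enlarging `Z` by vertices of a strongly connected component without outgoing edges in `D`
does not close a walk within `D`. -/
theorem OpenWalk.of_diff_scc {v a b : N} (h : G.OpenWalk (Z \ G.scc v) D a b)
    (hsink : ∀ c ∈ G.scc v, ∀ d ∈ D, G.dir c d → d ∈ G.scc v) : G.OpenWalk Z D a b := by
  refine h.imp fun _ h => Relation.ReflTransGen.mono (fun p q h => ?_) _ _ h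
  -- Edges from the component stay in it within `D`, so its vertices, restored to `Z`, never block
  -- as non-colliders.
  have key : ∀ c ∈ D, ∀ d ∈ D, G.dir c d → (c ∈ Z \ G.scc v → d ∈ G.scc c) → c ∈ Z →
      d ∈ G.scc c := by
    intro c _ d hd hcd hZ hcZ
    by_cases hc : c ∈ G.scc v
    · exact scc_trans (hsink c hc d hd hcd) (scc_symm hc)
    · exact hZ ⟨hcZ, hc⟩
  cases h with
  | fwd s ha hb h hZ => exact .fwd s ha hb h (key _ ha _ hb h hZ)
  | bwd s ha hb h hs hZ =>
    refine .bwd s ha hb h (fun e => ?_) (key _ hb _ ha h hZ)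
    obtain ⟨z, hz, hzr⟩ := hs e
    exact ⟨z, hz.1, hzr⟩

/-- Within a strongly connected component, walks that follow the edges are open. -/
theorem exists_forward_walk {v a b : N} (hD : G.scc v ⊆ D) (ha : a ∈ G.scc v) (hb : b ∈ G.scc v)
    (s : Bool) : ∃ t, Relation.ReflTransGen (G.OpenStep Z D) (a, s) (b, t) := by
  have hab : G.Reaches a b := ha.1.trans hb.2
  induction hab with
  | refl => exact ⟨s, .refl⟩
  | @tail c d hac hcd ih =>
    have hc : c ∈ G.scc v := ⟨(Relation.ReflTransGen.single hcd).trans hb.1, ha.2.trans hac⟩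
    obtain ⟨t, ht⟩ := ih hc
    exact ⟨true, ht.tail (.fwd t (hD hc) (hD hb) hcd fun _ => scc_trans hb (scc_symm hc))⟩

/-- Within a strongly connected component, walks against the direction of the edges are open. -/
theorem backward_walk {v a b : N} (hD : G.scc v ⊆ D) (ha : a ∈ G.scc v) (hb : b ∈ G.scc v) :
    Relation.ReflTransGen (G.OpenStep Z D) (a, false) (b, false) := by
  have hba : G.Reaches b a := hb.1.trans ha.2
  induction hba using Relation.ReflTransGen.head_induction_on with
  | refl => exact .refl
  | @head d c hdc hca ih =>
    have hc : c ∈ G.scc v := ⟨hca.trans ha.1, hb.2.tail hdc⟩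
    exact (ih hc).tail (.bwd false (hD hc) (hD hb) hdc (by simp)
      fun _ => scc_trans hc (scc_symm hb))

/-- Take a vertex of `D \ W` with the fewest descendants. Any other vertex of `D` that it reaches
has a parent, so lies outside `W`; by minimality it has the same descendants and thus reaches back.
-/
theorem exists_sink_scc [Finite N] {D W : Set N} (hroot : ∀ w ∈ W, ∀ u, ¬ G.dir u w)
    (hne : (D \ W).Nonempty) :
    ∃ v ∈ D, v ∉ W ∧ ∀ u ∈ D, G.Reaches v u → u ∈ G.scc v := by
  obtain ⟨v, ⟨hvD, hvW⟩, hmin⟩ := Set.exists_min_image (D \ W) (fun v => {u | G.Reaches v u}.ncard)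
    (Set.toFinite _) hne
  refine ⟨v, hvD, hvW, fun u hu hvu => ⟨?_, hvu⟩⟩
  by_cases huv : u = v
  · rw [huv]; exact .refl
  have huW : u ∉ W := by
    intro huW
    rcases Relation.ReflTransGen.cases_tail hvu with h | ⟨c, _, hc⟩
    · exact huv h
    · exact hroot u huW c hc
  have hsub : {x | G.Reaches u x} ⊆ {x | G.Reaches v x} := fun x hx => hvu.trans hx
  have := Set.eq_of_subset_of_ncard_le hsub (hmin u ⟨hu, huW⟩) (Set.toFinite _)
  have hv : v ∈ {x | G.Reaches u x} := this ▸ Relation.ReflTransGen.refl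
  exact hv

end Components

/-! ### Conditional independence of coordinates. -/

section Coordinates

variable {V : Type*} {𝒳 : V → Type*} [∀ v, MeasurableSpace (𝒳 v)]

/-- The σ-algebra generated by the coordinates in `A`. -/
abbrev coordAlgebra (𝒳 : V → Type*) [∀ v, MeasurableSpace (𝒳 v)] (A : Set V) :
    MeasurableSpace (∀ v, 𝒳 v) :=
  MeasurableSpace.comap (coords (𝒳 := 𝒳) A) inferInstance

theorem coordAlgebra_le (A : Set V) : coordAlgebra 𝒳 A ≤ MeasurableSpace.pi :=
  (measurable_coords A).comap_le

theorem coordAlgebra_eq_iSup (A : Set V) : coordAlgebra 𝒳 A =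
    ⨆ v ∈ A, MeasurableSpace.comap (fun x : ∀ v, 𝒳 v => x v) inferInstance := by
  simp only [coordAlgebra, MeasurableSpace.pi, MeasurableSpace.comap_iSup,
    MeasurableSpace.comap_comp, iSup_subtype']
  rfl

theorem coordAlgebra_mono {A B : Set V} (h : A ⊆ B) : coordAlgebra 𝒳 A ≤ coordAlgebra 𝒳 B := by
  rw [coordAlgebra_eq_iSup, coordAlgebra_eq_iSup]
  exact biSup_mono h

theorem coordAlgebra_union (A B : Set V) :
    coordAlgebra 𝒳 (A ∪ B) = coordAlgebra 𝒳 A ⊔ coordAlgebra 𝒳 B := by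
  simp only [coordAlgebra_eq_iSup, iSup_union]

theorem coordAlgebra_empty : coordAlgebra 𝒳 (∅ : Set V) = ⊥ := by
  simp [coordAlgebra_eq_iSup]

theorem measurable_coord {A : Set V} {v : V} (hv : v ∈ A) :
    Measurable[coordAlgebra 𝒳 A] fun x : ∀ v, 𝒳 v => x v :=
  (measurable_pi_apply (⟨v, hv⟩ : A)).comp (comap_measurable (coords (𝒳 := 𝒳) A))

/-- If the coordinates in `C` are almost surely a function of those in `Q`, then events in the
coordinates in `A` are, up to null sets, events in the coordinates in `(A \ C) ∪ Q`. -/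
theorem exists_ae_eq_of_coords_eq {μ : Measure (∀ v, 𝒳 v)} {C Q : Set V}
    {h : (∀ v : Q, 𝒳 v) → ∀ v : C, 𝒳 v} (hh : Measurable h)
    (hae : ∀ᵐ x ∂μ, coords C x = h (coords Q x)) (A : Set V) (s : Set (∀ v, 𝒳 v))
    (hs : MeasurableSet[coordAlgebra 𝒳 A] s) :
    ∃ t, MeasurableSet[coordAlgebra 𝒳 (A \ C ∪ Q)] t ∧ s =ᵐ[μ] t := by
  classical
  obtain ⟨T, hT, rfl⟩ := hs
  -- `Φ` overwrites the coordinates in `C` by `h`. It is almost surely the identity, and its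
  -- `A`-coordinates depend only on `(A \ C) ∪ Q`.
  let Φ : (∀ v, 𝒳 v) → ∀ v, 𝒳 v := fun x v => if hv : v ∈ C then h (coords Q x) ⟨v, hv⟩ else x v
  have hΦ : Measurable[coordAlgebra 𝒳 (A \ C ∪ Q)] fun x => coords A (Φ x) := by
    refine @measurable_pi_lambda _ _ _ (coordAlgebra 𝒳 (A \ C ∪ Q)) _ _ fun v => ?_
    by_cases hv : v.1 ∈ C
    · simp only [coords, Φ, hv, dite_true]
      exact (measurable_pi_apply (⟨v, hv⟩ : C)).comp (hh.comp
        ((comap_measurable (coords (𝒳 := 𝒳) Q)).mono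
          (coordAlgebra_mono Set.subset_union_right) le_rfl))
    · simp only [coords, Φ, hv, dite_false]
      exact measurable_coord (Or.inl ⟨v.2, hv⟩)
  refine ⟨(fun x => coords A (Φ x)) ⁻¹' T, hΦ hT, ?_⟩
  filter_upwards [hae] with x hx
  have : Φ x = x := by
    funext v
    by_cases hv : v ∈ C
    · simp only [Φ, hv, dite_true, ← hx, coords]
    · simp only [Φ, hv, dite_false]
  apply propext
  change coords A x ∈ T ↔ coords A (Φ x) ∈ T
  rw [this]

variable [Finite V] [∀ v, StandardBorelSpace (𝒳 v)] (μ : Measure (∀ v, 𝒳 v)) [IsFiniteMeasure μ]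

/-- The coordinates in `A` and in `B` are conditionally independent given those in `Z`. -/
def CoordCondIndep (A B Z : Set V) : Prop :=
  CondIndep (coordAlgebra 𝒳 Z) (coordAlgebra 𝒳 A) (coordAlgebra 𝒳 B) (coordAlgebra_le Z) μ

variable {μ} {A A' B Z : Set V}

theorem CoordCondIndep.symm (h : CoordCondIndep μ A B Z) : CoordCondIndep μ B A Z :=
  CondIndep.symm h

theorem CoordCondIndep.mono_left (h : CoordCondIndep μ A B Z) (hA : A' ⊆ A) :
    CoordCondIndep μ A' B Z :=
  condIndep_of_condIndep_of_le_left h (coordAlgebra_mono hA)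

theorem CoordCondIndep.union_left (h : CoordCondIndep μ A B Z) : CoordCondIndep μ (A ∪ Z) B Z := by
  rw [CoordCondIndep, coordAlgebra_union]
  exact CondIndep.sup_left _ (coordAlgebra_le A) (coordAlgebra_le B) h

theorem CoordCondIndep.of_diff_left (h : CoordCondIndep μ (A \ Z) B Z) : CoordCondIndep μ A B Z :=
  h.union_left.mono_left (by simp)

theorem CoordCondIndep.of_diff (h : CoordCondIndep μ (A \ Z) (B \ Z) Z) :
    CoordCondIndep μ A B Z :=
  (h.of_diff_left.symm.of_diff_left).symm

theorem CoordCondIndep.weak_union {K : Set V} (h : CoordCondIndep μ (A ∪ K) B Z) :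
    CoordCondIndep μ A B (K ∪ Z) := by
  rw [CoordCondIndep, coordAlgebra_union] at h
  have := CondIndep.weak_union _ (coordAlgebra_le A) (coordAlgebra_le B) (coordAlgebra_le K) h
  unfold CoordCondIndep
  convert this using 1
  exact coordAlgebra_union K Z

/-- The coordinates in `C` carry no information beyond those in `Q`, and the part of `Q` in `Z` is
known from the conditioning. -/
theorem CoordCondIndep.of_coords_eq {C Q : Set V} {f : (∀ v : Q, 𝒳 v) → ∀ v : C, 𝒳 v}
    (hf : Measurable f) (hae : ∀ᵐ x ∂μ, coords C x = f (coords Q x))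
    (h : CoordCondIndep μ (A \ C ∪ Q \ Z) B Z) : CoordCondIndep μ A B Z := by
  have h' : CoordCondIndep μ (A \ C ∪ Q) B Z := by
    refine h.union_left.mono_left ?_
    rw [Set.union_assoc, Set.sdiff_union_self]
    exact Set.union_subset_union_right _ Set.subset_union_left
  exact CondIndep.of_ae_eq_left _ (coordAlgebra_le _) (coordAlgebra_le _) (coordAlgebra_le _) h'
    (exists_ae_eq_of_coords_eq hf hae A)

/-- Weak union, starting from the trivial conditioning σ-algebra, moves `K` into the condition. -/
theorem coordCondIndep_of_indep [IsProbabilityMeasure μ] {K : Set V}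
    (h : Indep (coordAlgebra 𝒳 (A ∪ K)) (coordAlgebra 𝒳 B) μ) : CoordCondIndep μ A B K := by
  have h' : CoordCondIndep μ (A ∪ K) B ∅ := by
    unfold CoordCondIndep
    convert condIndep_bot_of_indep (coordAlgebra_le _) (coordAlgebra_le _) h using 1
    exact coordAlgebra_empty
  simpa using h'.weak_union

end Coordinates

/-! ### The Markov property by induction over ancestral sets. -/

section Markov

variable {V : Type*} {G : MixedGraph V}

/-- If a component without vertices in `Z` meets `A`, then its vertices in `A` can be replaced by
the parents of the component that are not in `Z`; moreover, it does not meet `B`. -/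
theorem WalkSeparated.parents_left {v : V} {A B Z D Q : Set V} (hCD : G.scc v ⊆ D)
    (hanc : ∀ u v, G.dir u v → v ∈ D → u ∈ D) (hZC : Disjoint Z (G.scc v))
    (hQ : ∀ q ∈ Q, ∃ c ∈ G.scc v, G.dir q c) (hsep : G.WalkSeparated D A B Z)
    (hA : (A ∩ G.scc v).Nonempty) :
    G.WalkSeparated (D \ G.scc v) (A \ G.scc v ∪ Q \ Z) B Z ∧ Disjoint B (G.scc v) := by
  obtain ⟨a, haA, haC⟩ := hA
  have hZ : ∀ c ∈ G.scc v, c ∉ Z := fun c hc hcZ => Set.disjoint_left.1 hZC hcZ hc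
  refine ⟨?_, ?_⟩
  · rintro q (⟨hqA, -⟩ | ⟨hqQ, hqZ⟩) b hb hqZ' hbZ hw
    · exact hsep q hqA b hb hqZ' hbZ (hw.mono Set.sdiff_subset)
    · obtain ⟨c, hc, hqc⟩ := hQ q hqQ
      refine hsep a haA b hb (hZ a haC) hbZ ?_
      refine (hw.mono Set.sdiff_subset).imp fun t ht => ?_
      -- Going against the edges from `a` to `c` and on to `q` keeps the flag `false`, exactly the
      -- state in which the given walk starts at `q`.
      refine ((backward_walk hCD haC hc).tail ?_).trans ht
      exact .bwd false (hCD hc) (hanc _ _ hqc (hCD hc)) hqc (by simp) fun h => absurd h hqZ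
  · rw [Set.disjoint_left]
    intro b hbB hbC
    exact hsep a haA b hbB (hZ a haC) (hZ b hbC) (exists_forward_walk hCD haC hbC false)

/-- The counterpart of `WalkSeparated.parents_left` for `B`. -/
theorem WalkSeparated.parents_right {v : V} {A B Z D Q : Set V} (hCD : G.scc v ⊆ D)
    (hanc : ∀ u v, G.dir u v → v ∈ D → u ∈ D) (hZC : Disjoint Z (G.scc v))
    (hQ : ∀ q ∈ Q, ∃ c ∈ G.scc v, G.dir q c) (hsep : G.WalkSeparated D A B Z)
    (hB : (B ∩ G.scc v).Nonempty) :
    G.WalkSeparated (D \ G.scc v) A (B \ G.scc v ∪ Q \ Z) Z := by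
  obtain ⟨b, hbB, hbC⟩ := hB
  have hbZ : b ∉ Z := fun h => Set.disjoint_left.1 hZC h hbC
  rintro a ha q (⟨hqB, -⟩ | ⟨hqQ, hqZ⟩) haZ hqZ' hw
  · exact hsep a ha q hqB haZ hqZ' (hw.mono Set.sdiff_subset)
  · obtain ⟨c, hc, hqc⟩ := hQ q hqQ
    obtain ⟨t, ht⟩ := hw.mono (Set.sdiff_subset : D \ G.scc v ⊆ D)
    obtain ⟨t', ht'⟩ := exists_forward_walk (Z := Z) hCD hc hbC true
    -- Extend the walk along `q → c` and then along edges inside the component; forward steps make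
    -- no colliders.
    refine hsep a ha b hbB haZ hbZ ⟨t', (ht.tail ?_).trans ht'⟩
    exact .fwd t (hanc _ _ hqc (hCD hc)) (hCD hc) hqc fun h => absurd h hqZ

variable {𝒳 : V → Type*} [∀ v, MeasurableSpace (𝒳 v)]
  [Finite V] [∀ v, StandardBorelSpace (𝒳 v)] {μ : Measure (∀ v, 𝒳 v)} [IsProbabilityMeasure μ]

/-- If the vertices of `W` have no parents and independent values, and the values in every other
strongly connected component are a function of the values of its parents, then walks that are
σ-separated within an ancestral set give rise to conditional independences. -/
theorem WalkSeparated.coordCondIndep {W : Set V} (hroot : ∀ w ∈ W, ∀ u, ¬ G.dir u w)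
    (hindep : ∀ A B : Set V, A ⊆ W → B ⊆ W → Disjoint A B →
      Indep (coordAlgebra 𝒳 A) (coordAlgebra 𝒳 B) μ)
    (hcomp : ∀ v, v ∉ W → ∃ (Q : Set V) (h : (∀ u : Q, 𝒳 u) → ∀ u : G.scc v, 𝒳 u),
      (∀ q ∈ Q, q ∉ G.scc v ∧ ∃ c ∈ G.scc v, G.dir q c) ∧ Measurable h ∧
      ∀ᵐ x ∂μ, coords (G.scc v) x = h (coords Q x))
    {D : Set V} (hWD : W ⊆ D) (hanc : ∀ u v, G.dir u v → v ∈ D → u ∈ D) {A B Z : Set V}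
    (hA : A ⊆ D) (hB : B ⊆ D) (hZ : Z ⊆ D) (hsep : G.WalkSeparated D A B Z) :
    CoordCondIndep μ A B Z := by
  induction hn : D.ncard using Nat.strong_induction_on generalizing D A B Z with
  | _ n ih =>
  subst hn
  by_cases hne : (D \ W).Nonempty
  swap
  · have hDW : D ⊆ W := Set.sdiff_eq_empty.1 (Set.not_nonempty_iff_eq_empty.1 hne)
    refine CoordCondIndep.of_diff (coordCondIndep_of_indep (hindep _ _ ?_ ?_ ?_))
    · exact Set.union_subset ((Set.sdiff_subset.trans hA).trans hDW) (hZ.trans hDW)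
    · exact (Set.sdiff_subset.trans hB).trans hDW
    · rw [Set.disjoint_left]
      rintro x (⟨hxA, hxZ⟩ | hxZ) ⟨hxB, hxZ'⟩
      -- A common vertex outside `Z` would be an open walk of length zero.
      · exact hsep x hxA x hxB hxZ hxZ ⟨false, .refl⟩
      · exact hxZ' hxZ
  obtain ⟨v, hvD, hvW, hsink⟩ := exists_sink_scc hroot hne
  obtain ⟨Q, f, hQ, hf, hae⟩ := hcomp v hvW
  have hDreach : ∀ u w, G.Reaches u w → w ∈ D → u ∈ D := by
    intro u w h
    induction h using Relation.ReflTransGen.head_induction_on with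
    | refl => exact id
    | head h _ ih => exact fun hw => hanc _ _ h (ih hw)
  have hCD : G.scc v ⊆ D := fun u hu => hDreach u v hu.1 hvD
  have hQ' : ∀ q ∈ Q, ∃ c ∈ G.scc v, G.dir q c := fun q hq => (hQ q hq).2
  have hQD : Q ⊆ D \ G.scc v := fun q hq => by
    obtain ⟨hqC, c, hc, hqc⟩ := hQ q hq
    exact ⟨hanc _ _ hqc (hCD hc), hqC⟩
  have hsink' : ∀ c ∈ G.scc v, ∀ d ∈ D, G.dir c d → d ∈ G.scc v := fun c hc d hd hcd =>
    hsink d hd (hc.2.tail hcd)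
  have hWC : Disjoint W (G.scc v) := by
    rw [Set.disjoint_left]
    intro w hw hwC
    rcases Relation.ReflTransGen.cases_tail hwC.2 with h | ⟨c, _, hc⟩
    · exact hvW (h ▸ hw)
    · exact hroot w hw c hc
  have ih' : ∀ {A B Z : Set V}, A ⊆ D \ G.scc v → B ⊆ D \ G.scc v → Z ⊆ D \ G.scc v →
      G.WalkSeparated (D \ G.scc v) A B Z → CoordCondIndep μ A B Z := by
    intro A B Z hA hB hZ hsep
    refine ih _ (Set.ncard_lt_ncard ⟨Set.sdiff_subset, fun h => (h hvD).2 (self_mem_scc v)⟩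
      (Set.toFinite D)) (Set.subset_sdiff.2 ⟨hWD, hWC⟩) ?_ hA hB hZ hsep rfl
    intro u w huw hw
    exact ⟨hanc u w huw hw.1, fun hu => hw.2 (hsink' u hu w hw.1 huw)⟩
  -- The case where `Z` misses the component: members of the component in `A` or `B` are traded for
  -- its parents outside `Z`.
  have hdisj : ∀ {A B Z : Set V}, A ⊆ D → B ⊆ D → Z ⊆ D → Disjoint Z (G.scc v) →
      G.WalkSeparated D A B Z → CoordCondIndep μ A B Z := by
    intro A B Z hA hB hZ hZC hsep
    have hZ' : Z ⊆ D \ G.scc v := Set.subset_sdiff.2 ⟨hZ, hZC⟩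
    have hun : ∀ {A : Set V}, A ⊆ D → A \ G.scc v ∪ Q \ Z ⊆ D \ G.scc v := fun hA =>
      Set.union_subset (Set.sdiff_subset_sdiff_left hA) (Set.sdiff_subset.trans hQD)
    by_cases hAC : (A ∩ G.scc v).Nonempty
    · obtain ⟨hsep', hBC⟩ := hsep.parents_left hCD hanc hZC hQ' hAC
      exact (ih' (hun hA) (Set.subset_sdiff.2 ⟨hB, hBC⟩) hZ' hsep').of_coords_eq hf hae
    have hA' : A ⊆ D \ G.scc v := Set.subset_sdiff.2
      ⟨hA, Set.disjoint_iff_inter_eq_empty.2 (Set.not_nonempty_iff_eq_empty.1 hAC)⟩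
    by_cases hBC : (B ∩ G.scc v).Nonempty
    · have hsep' := hsep.parents_right hCD hanc hZC hQ' hBC
      exact ((ih' hA' (hun hB) hZ' hsep').symm.of_coords_eq hf hae).symm
    have hB' : B ⊆ D \ G.scc v := Set.subset_sdiff.2
      ⟨hB, Set.disjoint_iff_inter_eq_empty.2 (Set.not_nonempty_iff_eq_empty.1 hBC)⟩
    exact ih' hA' hB' hZ' fun a ha b hb haZ hbZ hw =>
      hsep a ha b hb haZ hbZ (hw.mono Set.sdiff_subset)
  by_cases hZC : (Z ∩ G.scc v).Nonempty
  swap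
  · exact hdisj hA hB hZ
      (Set.disjoint_iff_inter_eq_empty.2 (Set.not_nonempty_iff_eq_empty.1 hZC)) hsep
  obtain ⟨k, hkZ, hkC⟩ := hZC
  have hCan : ∀ c ∈ G.scc v, c ∈ G.ancestors Z := fun c hc => ⟨k, hkZ, hc.1.trans hkC.2⟩
  have hZ' : Z \ G.scc v ⊆ D := Set.sdiff_subset.trans hZ
  have hZ'C : Disjoint (Z \ G.scc v) (G.scc v) := Set.disjoint_sdiff_left
  have hK : (Z ∩ G.scc v) ∪ (Z \ G.scc v) = Z := Set.inter_union_sdiff Z _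
  have hlift : ∀ {a b : V}, G.OpenWalk (Z \ G.scc v) D a b → G.OpenWalk Z D a b :=
    fun h => h.of_diff_scc hsink'
  have hAZ : A \ Z ⊆ D := Set.sdiff_subset.trans hA
  have hBZ : B \ Z ⊆ D := Set.sdiff_subset.trans hB
  -- If both sides had open walks to the component given `Z \ G.scc v`, they would remain open given
  -- `Z` and could be joined by a forward walk inside the component, whose vertices are all
  -- ancestors of `Z`.
  have hor : (∀ a ∈ A \ Z, ∀ c ∈ G.scc v, ¬ G.OpenWalk (Z \ G.scc v) D a c) ∨
      (∀ c ∈ G.scc v, ∀ b ∈ B \ Z, ¬ G.OpenWalk (Z \ G.scc v) D c b) := by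
    by_contra! hcon
    obtain ⟨⟨a, ha, c, hc, hac⟩, c', hc', b, hb, hcb⟩ := hcon
    obtain ⟨s, hs⟩ := hlift hac
    obtain ⟨s', hs'⟩ := exists_forward_walk (Z := Z) hCD hc hc' s
    exact hsep a ha.1 b hb.1 ha.2 hb.2
      (openWalk_trans_of_mem_ancestors (hs.trans hs') (hCan c' hc') (hlift hcb))
  refine CoordCondIndep.of_diff ?_
  -- Adjoin the component to the side not known to be separated from it, keep only its part in `Z`,
  -- and move that part into the condition.
  have hfin : CoordCondIndep μ (A \ Z) (B \ Z) ((Z ∩ G.scc v) ∪ (Z \ G.scc v)) := by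
    rcases hor with h | h
    · have : CoordCondIndep μ (A \ Z) (B \ Z ∪ G.scc v) (Z \ G.scc v) := by
        refine hdisj hAZ (Set.union_subset hBZ hCD) hZ' hZ'C ?_
        rintro a ha b (hb | hb) _ _ hw
        · exact hsep a ha.1 b hb.1 ha.2 hb.2 (hlift hw)
        · exact h a ha b hb hw
      exact (this.symm.mono_left
        (Set.union_subset_union_right _ Set.inter_subset_right)).weak_union.symm
    · have : CoordCondIndep μ (A \ Z ∪ G.scc v) (B \ Z) (Z \ G.scc v) := by
        refine hdisj (Set.union_subset hAZ hCD) hBZ hZ' hZ'C ?_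
        rintro a (ha | ha) b hb _ _ hw
        · exact hsep a ha.1 b hb.1 ha.2 hb.2 (hlift hw)
        · exact h a ha b hb hw
      exact (this.mono_left
        (Set.union_subset_union_right _ Set.inter_subset_right)).weak_union
  rwa [hK] at hfin

end Markov

end MixedGraph

/-! ### From systems of constraints to the graph-theoretic hypotheses. -/

namespace ConstraintSystem

variable {V F Ω : Type*} {𝒳 : V → Type*} {𝒴 : F → Type*}
  [∀ v, MeasurableSpace (𝒳 v)] [∀ f, MeasurableSpace (𝒴 f)] [MeasurableSpace Ω]
  {P : Measure Ω} {M : ConstraintSystem 𝒳 𝒴 P} {m : Set (V × F)}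

/-- The oriented graph is bipartite, so a directed path between variables with only constraints
inside passes through exactly one. -/
theorem dir_marginalize_orient_iff {x y : V} : (M.orient m).marginalize.dir x y ↔
    ∃ f, (x ∈ M.vars f ∧ (x, f) ∉ m) ∧ y ∈ M.vars f ∧ (y, f) ∈ m := by
  constructor
  · rintro ⟨c, hxc, hcy⟩
    rcases c with c | f
    · exact hcy.elim
    · rcases Relation.ReflTransGen.cases_tail hxc with h | ⟨d, hxd, hdf, -⟩
      · cases h
      rcases d with d | d
      · rcases Relation.ReflTransGen.cases_tail hxd with h | ⟨e, _, _, h⟩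
        · cases h
          exact ⟨f, hdf, hcy⟩
        · simp at h
      · exact hdf.elim
  · rintro ⟨f, hxf, hfy⟩
    exact ⟨Sum.inr f, .single ⟨hxf, rfl⟩, hfy⟩

theorem reaches_orient {x y : V} (h : (M.orient m).marginalize.Reaches x y) :
    (M.orient m).Reaches (Sum.inl x) (Sum.inl y) := by
  induction h with
  | refl => exact .refl
  | tail _ h ih =>
    obtain ⟨f, hxf, hfy⟩ := dir_marginalize_orient_iff.1 h
    exact (ih.tail (c := Sum.inr f) hxf).tail hfy

/-- The variable that represents a vertex of the bipartite graph: a constraint is represented by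
the variable it is matched to. -/
noncomputable def IsPerfectMatching.representative (hm : M.IsPerfectMatching m) : V ⊕ F → V
  | .inl v => v
  | .inr f => (hm.constraint_matched f).choose

theorem IsPerfectMatching.representative_mem (hm : M.IsPerfectMatching m) (f : F) :
    (hm.representative (Sum.inr f), f) ∈ m := (hm.constraint_matched f).choose_spec.1

theorem IsPerfectMatching.representative_eq (hm : M.IsPerfectMatching m) {v : V} {f : F}
    (h : (v, f) ∈ m) : hm.representative (Sum.inr f) = v :=
  ((hm.constraint_matched f).choose_spec.2 v h).symm

/-- The only edge out of a constraint goes to its partner and collapses to a point; an edge `v → f`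
becomes an edge from `v` to the partner of `f`. -/
theorem IsPerfectMatching.reaches_representative (hm : M.IsPerfectMatching m) {x y : V ⊕ F}
    (h : (M.orient m).Reaches x y) :
    (M.orient m).marginalize.Reaches (hm.representative x) (hm.representative y) := by
  induction h with
  | refl => exact .refl
  | @tail y z _ h ih =>
    refine ih.trans ?_
    rcases y with y | y <;> rcases z with z | z
    · exact h.elim
    · have hz := hm.representative_mem z
      exact .single (dir_marginalize_orient_iff.2 ⟨z, h, (hm.edge _ _ hz).1, hz⟩)
    · rw [hm.representative_eq h.2]
      exact .refl
    · exact h.elim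

theorem IsPerfectMatching.representative_mem_scc (hm : M.IsPerfectMatching m) {v : V} {x : V ⊕ F}
    (h : x ∈ (M.orient m).scc (Sum.inl v)) :
    hm.representative x ∈ (M.orient m).marginalize.scc v :=
  ⟨hm.reaches_representative h.1, hm.reaches_representative h.2⟩

theorem inl_mem_scc {u v : V} (h : u ∈ (M.orient m).marginalize.scc v) :
    Sum.inl u ∈ (M.orient m).scc (Sum.inl v) := ⟨reaches_orient h.1, reaches_orient h.2⟩

/-- A variable matched to a constraint of the component represents it, hence lies in the component
after marginalization. So the variables solved for are exactly a component of the marginal graph. -/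
theorem IsPerfectMatching.preimage_inl (hm : M.IsPerfectMatching m) (v : V) :
    Sum.inl ⁻¹' ((M.orient m).scc (Sum.inl v) ∪ matchedTo m ((M.orient m).scc (Sum.inl v))) =
      (M.orient m).marginalize.scc v := by
  ext u
  constructor
  · rintro (h | ⟨u', f, huf, ⟨hu, hf⟩ | ⟨hu, -⟩⟩)
    · exact hm.representative_mem_scc h
    · cases hu
      have := hm.representative_mem_scc hf
      rwa [hm.representative_eq huf] at this
    · cases hu
  · exact fun h => Or.inl (inl_mem_scc h)

theorem IsPerfectMatching.exists_of_mem_preimage_inr (hm : M.IsPerfectMatching m) {v : V} {f : F}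
    (hf : f ∈ Sum.inr ⁻¹' ((M.orient m).scc (Sum.inl v) ∪
      matchedTo m ((M.orient m).scc (Sum.inl v)))) :
    ∃ c ∈ (M.orient m).marginalize.scc v, (c, f) ∈ m := by
  rcases hf with h | ⟨u, f', huf, ⟨hu, -⟩ | ⟨hu, h⟩⟩
  · exact ⟨_, hm.representative_mem_scc h, hm.representative_mem f⟩
  · cases hu
  · cases hu
    exact ⟨u, hm.representative_mem_scc h, huf⟩

theorem IsPerfectMatching.not_dir_exogenous (hm : M.IsPerfectMatching m) {w : V} (hw : w ∈ M.W)
    (u : V) : ¬ (M.orient m).marginalize.dir u w := by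
  rw [dir_marginalize_orient_iff]
  rintro ⟨f, -, -, h⟩
  exact (hm.edge w f h).2 hw

theorem measurable_exo_pi : Measurable fun ω w => M.exo w ω :=
  measurable_pi_lambda _ M.measurable_exo

theorem isProbabilityMeasure_solutionLaw [IsProbabilityMeasure P]
    {g : (∀ w : M.W, 𝒳 w) → ∀ v : (M.Wᶜ : Set V), 𝒳 v} (hg : Measurable g) :
    IsProbabilityMeasure (M.solutionLaw g) := by
  have : IsProbabilityMeasure M.exoLaw :=
    Measure.isProbabilityMeasure_map measurable_exo_pi.aemeasurable
  exact Measure.isProbabilityMeasure_map (M.measurable_combine hg).aemeasurable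

/-- The solution leaves exogenous coordinates unchanged, so their preimages under it are events of
the original variables. -/
theorem iIndepFun_solutionLaw [IsProbabilityMeasure P]
    {g : (∀ w : M.W, 𝒳 w) → ∀ v : (M.Wᶜ : Set V), 𝒳 v} (hg : Measurable g) :
    iIndepFun (fun (w : M.W) (x : ∀ v, 𝒳 v) => x w) (M.solutionLaw g) := by
  have hmeas : Measurable fun ω => M.combine (fun w => M.exo w ω) (g fun w => M.exo w ω) :=
    (M.measurable_combine hg).comp measurable_exo_pi
  have hlaw : M.solutionLaw g =
      P.map fun ω => M.combine (fun w => M.exo w ω) (g fun w => M.exo w ω) := by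
    rw [solutionLaw, exoLaw, Measure.map_map (M.measurable_combine hg) measurable_exo_pi]
    rfl
  rw [hlaw, iIndepFun_iff_measure_inter_preimage_eq_mul]
  intro S sets hsets
  have hexo := (iIndepFun_iff_measure_inter_preimage_eq_mul.1 M.indep_exo) S hsets
  have hpre : ∀ w ∈ S, MeasurableSet ((fun x : ∀ v, 𝒳 v => x w) ⁻¹' sets w) := fun w hw =>
    measurable_pi_apply (w : V) (hsets w hw)
  rw [Measure.map_apply hmeas (Finset.measurableSet_biInter _ hpre)]
  have hcomb : ∀ w : M.W, (fun ω => M.combine (fun w => M.exo w ω) (g fun w => M.exo w ω)) ⁻¹'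
      ((fun x : ∀ v, 𝒳 v => x w) ⁻¹' sets w) = M.exo w ⁻¹' sets w := by
    intro w
    ext ω
    simp [combine]
  simp only [Set.preimage_iInter, hcomb]
  rw [hexo]
  refine Finset.prod_congr rfl fun w hw => ?_
  rw [Measure.map_apply hmeas (hpre w hw), hcomb]

theorem indep_coordAlgebra_solutionLaw [IsProbabilityMeasure P]
    {g : (∀ w : M.W, 𝒳 w) → ∀ v : (M.Wᶜ : Set V), 𝒳 v} (hg : Measurable g) {A B : Set V}
    (hA : A ⊆ M.W) (hB : B ⊆ M.W) (hAB : Disjoint A B) :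
    Indep (MixedGraph.coordAlgebra 𝒳 A) (MixedGraph.coordAlgebra 𝒳 B) (M.solutionLaw g) := by
  have h := indep_iSup_of_disjoint (fun w : M.W => (measurable_pi_apply (w : V)).comap_le)
    (iIndepFun_solutionLaw hg).iIndep
    (S := Subtype.val ⁻¹' A) (T := Subtype.val ⁻¹' B) (hAB.preimage _)
  have key : ∀ A : Set V, A ⊆ M.W → MixedGraph.coordAlgebra 𝒳 A =
      ⨆ w ∈ (Subtype.val ⁻¹' A : Set M.W),
        MeasurableSpace.comap (fun x : ∀ v, 𝒳 v => x w) inferInstance := by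
    intro A hA
    rw [MixedGraph.coordAlgebra_eq_iSup]
    refine le_antisymm (iSup₂_le fun v hv => ?_) (iSup₂_le fun w hw => ?_)
    · exact le_iSup₂_of_le (⟨v, hA hv⟩ : M.W) hv le_rfl
    · exact le_iSup₂_of_le (w : V) hw le_rfl
  rw [key A hA, key B hB]
  exact h

/-- Under the solution, the variables of a strongly connected component of endogenous variables
are almost surely a function of the parents of the component. -/
theorem exists_coords_scc_eq {g : (∀ w : M.W, 𝒳 w) → ∀ v : (M.Wᶜ : Set V), 𝒳 v}
    [Finite V] [∀ v, StandardBorelSpace (𝒳 v)]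
    (hg : M.IsSolution g) (hm : M.IsPerfectMatching m)
    (hsolv : ∀ (a : V ⊕ F) (S : Set (V ⊕ F)), S = (M.orient m).scc a →
      (∀ w ∈ M.W, Sum.inl w ∉ S) →
      M.UniquelySolvable (Sum.inr ⁻¹' (S ∪ matchedTo m S)) (Sum.inl ⁻¹' (S ∪ matchedTo m S)))
    {v : V} (hv : v ∉ M.W) :
    ∃ (Q : Set V) (h : (∀ u : Q, 𝒳 u) → ∀ u : (M.orient m).marginalize.scc v, 𝒳 u),
      (∀ q ∈ Q, q ∉ (M.orient m).marginalize.scc v ∧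
        ∃ c ∈ (M.orient m).marginalize.scc v, (M.orient m).marginalize.dir q c) ∧
      Measurable h ∧ ∀ᵐ x ∂M.solutionLaw g,
        MixedGraph.coords ((M.orient m).marginalize.scc v) x = h (MixedGraph.coords Q x) := by
  have hsol := hsolv (Sum.inl v) _ rfl fun w hw hwS => by
    have hwC : w ∈ (M.orient m).marginalize.scc v := hm.representative_mem_scc hwS
    rcases Relation.ReflTransGen.cases_tail hwC.2 with h | ⟨c, _, hc⟩
    · exact hv (h ▸ hw)
    · exact hm.not_dir_exogenous hw c hc
  rw [hm.preimage_inl] at hsol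
  obtain ⟨hSV, h, hh, hae⟩ := hsol
  -- `Q` consists of the variables in the component's constraints that lie outside the component,
  -- and `h` is the solving function.
  refine ⟨_, h, ?_, hh, ?_⟩
  · rintro q ⟨hq, hqC⟩
    refine ⟨hqC, ?_⟩
    obtain ⟨f, hf, hqf⟩ := Set.mem_iUnion₂.1 hq
    obtain ⟨c, hc, hcf⟩ := hm.exists_of_mem_preimage_inr hf
    refine ⟨c, hc, dir_marginalize_orient_iff.2 ⟨f, ⟨hqf, fun hqm => ?_⟩, (hm.edge c f hcf).1,
      hcf⟩⟩
    -- Were `q` matched to `f`, it would equal the partner `c`, which is in the component.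
    exact hqC ((hm.constraint_matched f).unique hqm hcf ▸ hc)
  · have hmeas : MeasurableSet {x : ∀ v, 𝒳 v |
        MixedGraph.coords ((M.orient m).marginalize.scc v) x = h (MixedGraph.coords _ x)} :=
      measurableSet_eq_fun (MixedGraph.measurable_coords _)
        (hh.comp (MixedGraph.measurable_coords _))
    rw [solutionLaw, ae_map_iff (M.measurable_combine hg.1).aemeasurable hmeas]
    filter_upwards [hg.2, hae] with xW h1 h2
    -- The solution satisfies the constraints, so unique solvability at its realized values forces
    -- the component to be given by `h`.
    refine (h2 (fun u => M.combine xW (g xW) u) fun u hu => by simp [combine, hu]).1 ?_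
    exact fun f _ => h1 f

end ConstraintSystem

theorem theorem6 {V F Ω : Type*} [Finite V] [Finite F] {𝒳 : V → Type*} {𝒴 : F → Type*}
    [∀ v, MeasurableSpace (𝒳 v)] [∀ v, StandardBorelSpace (𝒳 v)]
    [∀ f, MeasurableSpace (𝒴 f)] [∀ f, StandardBorelSpace (𝒴 f)]
    [MeasurableSpace Ω] {P : Measure Ω} [IsProbabilityMeasure P]
    (M : ConstraintSystem 𝒳 𝒴 P)
    (g : (∀ w : M.W, 𝒳 w) → ∀ v : (M.Wᶜ : Set V), 𝒳 v) (hg : M.IsSolution g)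
    (m : Set (V × F)) (hm : M.IsPerfectMatching m)
    (hsolv : ∀ (a : V ⊕ F) (S : Set (V ⊕ F)), S = (M.orient m).scc a →
      (∀ w ∈ M.W, Sum.inl w ∉ S) →
      M.UniquelySolvable (Sum.inr ⁻¹' (S ∪ matchedTo m S)) (Sum.inl ⁻¹' (S ∪ matchedTo m S))) :
    (M.orient m).marginalize.GeneralizedMarkov (M.solutionLaw g) := by
  have := ConstraintSystem.isProbabilityMeasure_solutionLaw hg.1
  intro A B Z hsep
  rw [condIndepFun_iff_condIndep]
  exact MixedGraph.WalkSeparated.coordCondIndep (W := M.W)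
    (fun w hw u => hm.not_dir_exogenous hw u)
    (fun A B hA hB hAB => ConstraintSystem.indep_coordAlgebra_solutionLaw hg.1 hA hB hAB)
    (fun v hv => ConstraintSystem.exists_coords_scc_eq hg hm hsolv hv)
    (Set.subset_univ _) (fun _ _ _ _ => Set.mem_univ _) (Set.subset_univ _) (Set.subset_univ _)
    (Set.subset_univ _) hsep.walkSeparated
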